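/- Let $q$ be a complex number with $0<|q|<1$ and let $\ell\ge 0$ be an integer. Write $(a)_n=(a;q)_n=\prod_{i=0}^{n-1}(1-aq^i)$ and $(a)_\infty=\prod_{i\ge 0}(1-aq^i)$. For integers $s$ put $\binom{s}{2}=s(s-1)/2$. For integers $N,k$ let the Gaussian binomial coefficient be ${N\brack k}=\prod_{i=1}^{k}\frac{1-q^{N-i+1}}{1-q^{i}}$ if $k\ge 0$ and ${N\brack k}=0$ if $k<0$; so ${N\brack k}=\frac{(q)_N}{(q)_k(q)_{N-k}}$ for $0\le k\le N$, ${N\brack k}=0$ for $0\le N<k$, and ${-1\brack k}=(-1)^kq^{-k(k+1)/2}$ for $k\ge 0$. For $n\ge 0$ and $m\in\mathbb Z$ let \begin{align*} A_{n,m}=\sum_{k=0}^{\ell}(-1)^m q^{\binom{2m+2k-\ell}{2}+\binom{m+1}{2}}{\ell\brack k}\Bigg(&{2n-1\brack n-2m-2k+\ell}+q^{2m+2k-\ell}{2n-1\brack n-2m-2k+\ell-1}\\ &-q^{2(2m+2k-\ell)+1}{2n-1\brack n-2m-2k+\ell-2}-q^{3(2m+2k-\ell+1)}{2n-1\brack n-2m-2k+\ell-3}\Bigg).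 \end{align*} Then for every $n$ only finitely many $A_{n,m}$ are non-zero, the outer series over $n$ and the series over $j$ below converge absolutely, and \begin{align*} &\sum_{n=0}^{\infty}\frac{q^{n(n+1)}}{(q)_{2n}}\sum_{m=-\infty}^{\infty}A_{n,m}\\ &\quad=\frac{2}{(q)_\infty}\sum_{j=0}^{\infty}(-1)^j q^{\binom{j+1}{2}+(2j+\ell)(6j+3\ell+1)/2}\left(1-q^{4j+2\ell+1}+q^{6j+3\ell+2}-q^{10j+5\ell+5}\right)(q^{j+1})_\ell . \end{align*} -/

import Mathlib

namespace QSeries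

/-- The finite `q`-shifted factorial `(a; q)_n = ∏_{i=0}^{n-1} (1 - a q^i)`. -/
noncomputable def qPoch (a q : ℂ) (n : ℕ) : ℂ :=
  ∏ i ∈ Finset.range n, (1 - a * q ^ i)

/-- The infinite `q`-shifted factorial `(a; q)_∞ = ∏_{i ≥ 0} (1 - a q^i)`. -/
noncomputable def qPochInf (a q : ℂ) : ℂ :=
  ∏' i : ℕ, (1 - a * q ^ i)

/-- The Gaussian binomial coefficient with integer entries: it is `0` for `k < 0`, and for `k ≥ 0`
it is `(q^{n-k+1}; q)_k / (q; q)_k = ∏_{i=1}^{k} (1 - q^{n-i+1}) / (1 - q^i)`.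
For `0 ≤ k ≤ n` this is `(q)_n / ((q)_k (q)_{n-k})` (`gaussBinom_eq`), for `0 ≤ n < k` it vanishes
(`gaussBinom_eq_zero`), and the formula also makes sense for the negative upper entry `n = -1`. -/
noncomputable def gaussBinom (q : ℂ) (n k : ℤ) : ℂ :=
  if k < 0 then 0 else qPoch (q ^ (n - k + 1)) q k.toNat / qPoch q q k.toNat

/-- `binom(s, 2) = s (s - 1) / 2` for an integer `s` (the division is exact). -/
def choose2 (s : ℤ) : ℤ := s * (s - 1) / 2

/-- The `m`-th term (a sum over `0 ≤ k ≤ ℓ`) of the inner sum on the left-hand side. -/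
noncomputable def innerTerm (q : ℂ) (ℓ n : ℕ) (m : ℤ) : ℂ :=
  ∑ k ∈ Finset.range (ℓ + 1),
    (-1) ^ m * q ^ (choose2 (2 * m + 2 * k - ℓ) + choose2 (m + 1)) * gaussBinom q ℓ k *
      (gaussBinom q (2 * n - 1) (n - 2 * m - 2 * k + ℓ)
        + q ^ (2 * m + 2 * k - ℓ) * gaussBinom q (2 * n - 1) (n - 2 * m - 2 * k + ℓ - 1)
        - q ^ (2 * (2 * m + 2 * k - ℓ) + 1) *
            gaussBinom q (2 * n - 1) (n - 2 * m - 2 * k + ℓ - 2)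
        - q ^ (3 * (2 * m + 2 * k - ℓ + 1)) *
            gaussBinom q (2 * n - 1) (n - 2 * m - 2 * k + ℓ - 3))

/-- The `n`-th term of the outer sum on the left-hand side. -/
noncomputable def lhsTerm (q : ℂ) (ℓ n : ℕ) : ℂ :=
  q ^ (n * (n + 1)) / qPoch q q (2 * n) * ∑' m : ℤ, innerTerm q ℓ n m

/-- The `j`-th term of the sum on the right-hand side; the division by `2` is exact. -/
noncomputable def rhsTerm (q : ℂ) (ℓ j : ℕ) : ℂ :=
  (-1) ^ j * q ^ ((j + 1).choose 2 + (2 * j + ℓ) * (6 * j + 3 * ℓ + 1) / 2) *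
    (1 - q ^ (4 * j + 2 * ℓ + 1) + q ^ (6 * j + 3 * ℓ + 2) - q ^ (10 * j + 5 * ℓ + 5)) *
    qPoch (q ^ (j + 1)) q ℓ

theorem qPoch_self_ne_zero (q : ℂ) (hq : ‖q‖ < 1) (n : ℕ) : qPoch q q n ≠ 0 := by
  refine Finset.prod_ne_zero_iff.2 fun i _ h => ?_
  have h1 : q ^ (i + 1) = 1 := by
    rw [pow_succ']
    exact (sub_eq_zero.1 h).symm
  have h2 : ‖q‖ ^ (i + 1) < 1 := pow_lt_one₀ (norm_nonneg q) hq (Nat.succ_ne_zero i)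
  rw [← norm_pow, h1, norm_one] at h2
  exact lt_irrefl _ h2

theorem gaussBinom_eq (q : ℂ) (hq : ‖q‖ < 1) (n k : ℕ) (hk : k ≤ n) :
    gaussBinom q n k = qPoch q q n / (qPoch q q k * qPoch q q (n - k)) := by
  have hsplit : qPoch q q n = qPoch q q (n - k) * qPoch (q ^ ((n : ℤ) - k + 1)) q k := by
    obtain ⟨d, rfl⟩ := Nat.exists_eq_add_of_le' hk
    have he : ((d + k : ℕ) : ℤ) - k + 1 = ((d + 1 : ℕ) : ℤ) := by push_cast; ring
    rw [he, zpow_natCast, Nat.add_sub_cancel]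
    unfold qPoch
    rw [Finset.prod_range_add]
    congr 1
    refine Finset.prod_congr rfl fun i _ => ?_
    ring
  have h1 := qPoch_self_ne_zero q hq k
  have h2 := qPoch_self_ne_zero q hq (n - k)
  have h3 : ¬ ((k : ℤ) < 0) := by omega
  rw [gaussBinom, if_neg h3, Int.toNat_natCast, hsplit]
  field_simp

theorem gaussBinom_eq_zero (q : ℂ) (hq0 : q ≠ 0) (n k : ℕ) (hk : n < k) :
    gaussBinom q n k = 0 := by
  have h3 : ¬ ((k : ℤ) < 0) := by omega
  rw [gaussBinom, if_neg h3, Int.toNat_natCast]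
  have h : qPoch (q ^ ((n : ℤ) - k + 1)) q k = 0 := by
    refine Finset.prod_eq_zero (i := k - n - 1) (Finset.mem_range.2 (by omega)) ?_
    rw [← zpow_natCast q (k - n - 1), ← zpow_add₀ hq0]
    have : (n : ℤ) - k + 1 + ((k - n - 1 : ℕ) : ℤ) = 0 := by omega
    rw [this, zpow_zero, sub_self]
  rw [h, zero_div]

end QSeries

namespace QSeries

/-! The four Gaussian binomials in `innerTerm` pair off into `K(s) - K(s+2)`, where `K` is the even
function `symKernel q n` and `s = 2(m+k) - ℓ` (`gaussBinom_pair`, `innerTerm_eq`). Putting `r = m +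
k`, the `q`-binomial theorem sums over `k`, and `r = ℓ + j` turns the weight into `coeff q ℓ j`
(`sum_gaussBinom_mul_signPow`, `signPow_mul_prod`). Under `j ↦ -1-ℓ-j` the weight and the kernel
difference are both odd, and the weight vanishes for `-ℓ ≤ j < 0`; so the sum over `ℤ` is twice that
over `j ≥ 0`, whence the factor 2.

The difference splits as `D(s) + D(s+1)` with `D = kernelDiff q n`, free of the denominator `1 +
q^n`. Against `q^(n(n+1))`, each `D` sums over `n` by the Durfee rectangle identity `∑ q^(i²+ia) /
((q)_i (q)_{i+a}) = 1/(q)_∞`. Absolute convergence of the double series lets the sums over `n` and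
`j` be exchanged. -/

theorem two_mul_choose2 (s : ℤ) : 2 * choose2 s = s * (s - 1) := by
  have h : (2 : ℤ) ∣ s * (s - 1) := by
    have := (Int.even_mul_pred_self s).two_dvd
    simpa using this
  exact Int.mul_ediv_cancel' h

theorem choose2_add_one (s : ℤ) : choose2 (s + 1) = choose2 s + s := by
  have h1 := two_mul_choose2 s
  have h2 := two_mul_choose2 (s + 1)
  linarith

theorem choose2_neg (s : ℤ) : choose2 (-s) = choose2 (s + 1) := by
  have h1 := two_mul_choose2 (-s)
  have h2 := two_mul_choose2 (s + 1)
  linarith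

theorem choose2_nonneg (s : ℤ) : 0 ≤ choose2 s := by
  have h1 := two_mul_choose2 s
  have h2 : 0 ≤ s * (s - 1) := by
    rcases le_or_gt s 0 with h | h <;> nlinarith
  linarith

theorem zpow_ne_one_of_norm_lt_one {q : ℂ} (hq1 : ‖q‖ < 1) {k : ℤ} (hk : 0 < k) :
    q ^ k ≠ 1 := by
  lift k to ℕ using hk.le
  intro h
  rw [zpow_natCast] at h
  have h2 : ‖q‖ ^ k < 1 := pow_lt_one₀ (norm_nonneg q) hq1 (by omega)
  rw [← norm_pow, h, norm_one] at h2
  exact lt_irrefl _ h2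

theorem one_add_zpow_ne_zero {q : ℂ} (hq1 : ‖q‖ < 1) (n : ℕ) : 1 + q ^ (n : ℤ) ≠ 0 := by
  intro h
  rcases Nat.eq_zero_or_pos n with rfl | hn
  · norm_num at h
  · refine zpow_ne_one_of_norm_lt_one hq1 (k := n * 2) (by positivity) ?_
    rw [zpow_mul, eq_neg_of_add_eq_zero_right h]
    norm_num

/-- `1 / (q; q)_k`, extended by `0` to negative `k`. -/
noncomputable def invPoch (q : ℂ) (k : ℤ) : ℂ :=
  if k < 0 then 0 else (qPoch q q k.toNat)⁻¹

theorem invPoch_of_neg (q : ℂ) {k : ℤ} (hk : k < 0) : invPoch q k = 0 := if_pos hk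

theorem invPoch_natCast (q : ℂ) (k : ℕ) : invPoch q k = (qPoch q q k)⁻¹ := by
  rw [invPoch, if_neg (by omega), Int.toNat_natCast]

theorem qPoch_succ (a q : ℂ) (n : ℕ) : qPoch a q (n + 1) = qPoch a q n * (1 - a * q ^ n) :=
  Finset.prod_range_succ _ _

theorem qPoch_succ' (a q : ℂ) (n : ℕ) : qPoch a q (n + 1) = (1 - a) * qPoch (a * q) q n := by
  unfold qPoch
  rw [Finset.prod_range_succ', mul_comm]
  congr 1
  · simp
  · exact Finset.prod_congr rfl fun i _ => by ring

theorem invPoch_sub_one {q : ℂ} (hq1 : ‖q‖ < 1) (k : ℤ) :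
    invPoch q (k - 1) = (1 - q ^ k) * invPoch q k := by
  rcases lt_trichotomy k 0 with h | rfl | h
  · rw [invPoch_of_neg q h, invPoch_of_neg q (by omega), mul_zero]
  · rw [invPoch_of_neg q (by omega), zpow_zero, sub_self, zero_mul]
  · obtain ⟨n, rfl⟩ : ∃ n : ℕ, k = (n + 1 : ℕ) := ⟨(k - 1).toNat, by omega⟩
    rw [invPoch_natCast, show ((n + 1 : ℕ) : ℤ) - 1 = (n : ℕ) by push_cast; ring, invPoch_natCast,
      zpow_natCast]
    have h1 := qPoch_self_ne_zero q hq1 n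
    have h2 := qPoch_self_ne_zero q hq1 (n + 1)
    rw [qPoch_succ] at h2 ⊢
    have h3 := right_ne_zero_of_mul h2
    rw [← pow_succ'] at h3 ⊢
    field_simp

theorem gaussBinom_natCast {q : ℂ} (hq0 : q ≠ 0) (hq1 : ‖q‖ < 1) (n : ℕ) (k : ℤ) :
    gaussBinom q n k = qPoch q q n * (invPoch q k * invPoch q (n - k)) := by
  rcases lt_or_ge k 0 with h | h
  · rw [gaussBinom, if_pos h, invPoch_of_neg q h, zero_mul, mul_zero]
  · lift k to ℕ using h
    rcases le_or_gt k n with h | h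
    · rw [gaussBinom_eq q hq1 n k h, ← Nat.cast_sub h, invPoch_natCast, invPoch_natCast,
        div_eq_mul_inv, mul_inv]
    · rw [gaussBinom_eq_zero q hq0 n k h, invPoch_of_neg q (k := n - k) (by omega), mul_zero,
        mul_zero]

/-- Needed for `n = 0`, where the upper entry `2n - 1` is `-1`. -/
theorem gaussBinom_neg_one {q : ℂ} (hq0 : q ≠ 0) (hq1 : ‖q‖ < 1) {k : ℤ} (hk : 0 < k) :
    gaussBinom q (-1) k + q ^ (-k) * gaussBinom q (-1) (k - 1) = 0 := by
  obtain ⟨n, rfl⟩ : ∃ n : ℕ, k = (n + 1 : ℕ) := ⟨(k - 1).toNat, by omega⟩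
  rw [gaussBinom, gaussBinom, if_neg (by omega), if_neg (by omega), Int.toNat_natCast,
    show (((n + 1 : ℕ) : ℤ) - 1).toNat = n by omega, qPoch_succ', qPoch_succ,
    ← zpow_add_one₀ hq0, ← pow_succ', show (-1 : ℤ) - (n + 1 : ℕ) + 1 = -((n + 1 : ℕ) : ℤ) by ring,
    show (-1 : ℤ) - ((n + 1 : ℕ) - 1) + 1 = -((n + 1 : ℕ) : ℤ) + 1 by ring, zpow_neg, zpow_natCast]
  have h1 := qPoch_self_ne_zero q hq1 n
  have h2 := qPoch_self_ne_zero q hq1 (n + 1)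
  rw [qPoch_succ, ← pow_succ'] at h2
  have h3 := right_ne_zero_of_mul h2
  have h4 : q ^ (n + 1) ≠ 0 := pow_ne_zero _ hq0
  generalize q ^ (n + 1) = x at *
  field_simp
  ring

/-! ### The symmetric kernel and its differences -/

/-- The symmetric kernel `q^{binom(s,2)} (1 + q^s) / ((1 + q^n) (q)_{n-s} (q)_{n+s})`. -/
noncomputable def symKernel (q : ℂ) (n : ℕ) (s : ℤ) : ℂ :=
  q ^ choose2 s * ((1 + q ^ s) / (1 + q ^ (n : ℤ)) * (invPoch q (n - s) * invPoch q (n + s)))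

/-- Over a common denominator the numerator is `(1 - q^(n+s)) + q^s (1 - q^(n-s)) = (1 + q^s)(1 -
q^n)`, and `1 - q^n = (1 - q^(2n)) / (1 + q^n)`. -/
theorem gaussBinom_pair {q : ℂ} (hq0 : q ≠ 0) (hq1 : ‖q‖ < 1) (n : ℕ) (s : ℤ) :
    gaussBinom q (2 * n - 1) (n - s) + q ^ s * gaussBinom q (2 * n - 1) (n - s - 1) =
      qPoch q q (2 * n) *
        ((1 + q ^ s) / (1 + q ^ (n : ℤ)) * (invPoch q (n - s) * invPoch q (n + s))) := by
  rcases n with _ | n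
  · simp only [Nat.cast_zero, mul_zero, zero_sub, zero_add]
    rcases lt_trichotomy s 0 with h | rfl | h
    · have := gaussBinom_neg_one hq0 hq1 (k := -s) (by omega)
      rw [neg_neg] at this
      rw [this, invPoch_of_neg q h]
      simp
    · simp [gaussBinom, invPoch, qPoch]
    · rw [gaussBinom, if_pos (by omega), gaussBinom, if_pos (by omega),
        invPoch_of_neg q (k := -s) (by omega)]
      simp
  · have e : (2 * ((n + 1 : ℕ) : ℤ) - 1) = (2 * n + 1 : ℕ) := by push_cast; ring
    rw [e, gaussBinom_natCast hq0 hq1, gaussBinom_natCast hq0 hq1,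
      show 2 * (n + 1) = 2 * n + 1 + 1 by ring, qPoch_succ q q (2 * n + 1), ← pow_succ',
      show ((2 * n + 1 : ℕ) : ℤ) - ((n + 1 : ℕ) - s) = (n + 1 : ℕ) + s - 1 by push_cast; ring,
      show ((2 * n + 1 : ℕ) : ℤ) - ((n + 1 : ℕ) - s - 1) = (n + 1 : ℕ) + s by push_cast; ring,
      invPoch_sub_one hq1, invPoch_sub_one hq1, zpow_add₀ hq0, zpow_sub₀ hq0,
      show q ^ (2 * n + 1 + 1) = q ^ (((n + 1 : ℕ)) : ℤ) * q ^ (((n + 1 : ℕ)) : ℤ) by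
        rw [zpow_natCast]; ring]
    have h1 := one_add_zpow_ne_zero hq1 (n + 1)
    have h2 : q ^ s ≠ 0 := zpow_ne_zero _ hq0
    generalize q ^ (((n + 1 : ℕ)) : ℤ) = x at *
    generalize q ^ s = y at *
    field_simp
    ring

theorem symKernel_neg {q : ℂ} (hq0 : q ≠ 0) (n : ℕ) (s : ℤ) :
    symKernel q n (-s) = symKernel q n s := by
  rw [symKernel, symKernel, choose2_neg, choose2_add_one, zpow_add₀ hq0, zpow_neg,
    sub_neg_eq_add, ← sub_eq_add_neg]
  have h2 : q ^ s ≠ 0 := zpow_ne_zero _ hq0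
  field_simp
  ring

theorem symKernel_eq_zero (q : ℂ) (n : ℕ) (s : ℤ) (hs : n < |s|) : symKernel q n s = 0 := by
  rcases lt_abs.1 hs with h | h
  · rw [symKernel, invPoch_of_neg q (k := n - s) (by omega), zero_mul, mul_zero, mul_zero]
  · rw [symKernel, invPoch_of_neg q (k := n + s) (by omega), mul_zero, mul_zero, mul_zero]

/-- The forward difference of `symKernel`, see `symKernel_sub_symKernel`. -/
noncomputable def kernelDiff (q : ℂ) (n : ℕ) (s : ℤ) : ℂ :=
  q ^ choose2 s * (1 - q ^ (2 * s + 1)) * (invPoch q (n - s) * invPoch q (n + s + 1))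

/-- The numerator `(1 + q^s)(1 - q^(n+s+1)) - q^s (1 + q^(s+1))(1 - q^(n-s))` equals `(1 + q^n)(1 -
q^(2s+1))`, which cancels `1 + q^n`. -/
theorem symKernel_sub_symKernel {q : ℂ} (hq0 : q ≠ 0) (hq1 : ‖q‖ < 1) (n : ℕ) (s : ℤ) :
    symKernel q n s - symKernel q n (s + 1) = kernelDiff q n s := by
  have e1 : invPoch q (n + s) = (1 - q ^ ((n : ℤ) + s + 1)) * invPoch q (n + s + 1) := by
    rw [← invPoch_sub_one hq1, add_sub_cancel_right]
  have e2 : invPoch q (n - (s + 1)) = (1 - q ^ ((n : ℤ) - s)) * invPoch q (n - s) := by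
    rw [← invPoch_sub_one hq1]
    congr 1
    ring
  rw [symKernel, symKernel, kernelDiff, choose2_add_one, zpow_add₀ hq0, e1, e2, ← add_assoc,
    zpow_add_one₀ hq0, zpow_add_one₀ hq0, zpow_add_one₀ hq0, zpow_add₀ hq0, zpow_sub₀ hq0,
    two_mul, zpow_add₀ hq0]
  have h1 := one_add_zpow_ne_zero hq1 n
  have h2 : q ^ s ≠ 0 := zpow_ne_zero _ hq0
  generalize q ^ (n : ℤ) = x at *
  generalize q ^ s = y at *
  field_simp
  ring

/-! ### Summation over `k` and the weight in `j` -/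

/-- The sign and power of `q` attached to `m` in the inner sum. -/
noncomputable def signPow (q : ℂ) (m : ℤ) : ℂ := (-1) ^ m * q ^ choose2 (m + 1)

theorem signPow_add_one {q : ℂ} (hq0 : q ≠ 0) (m : ℤ) :
    signPow q (m + 1) = -(q ^ (m + 1) * signPow q m) := by
  rw [signPow, signPow, choose2_add_one (m + 1), zpow_add₀ hq0, zpow_add_one₀ (by norm_num)]
  ring

theorem signPow_neg (q : ℂ) (m : ℤ) : signPow q (-1 - m) = -signPow q m := by
  rw [signPow, signPow, show -1 - m + 1 = -m by ring, choose2_neg,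
    zpow_sub₀ (by norm_num : (-1 : ℂ) ≠ 0)]
  rcases Int.even_or_odd m with h | h
  · rw [h.neg_one_zpow]
    norm_num
  · rw [h.neg_one_zpow]
    norm_num

theorem innerTerm_eq {q : ℂ} (hq0 : q ≠ 0) (hq1 : ‖q‖ < 1) (ℓ n : ℕ) (m : ℤ) :
    innerTerm q ℓ n m = qPoch q q (2 * n) * ∑ k ∈ Finset.range (ℓ + 1),
      gaussBinom q ℓ k * (signPow q m *
        (symKernel q n (2 * (m + k) - ℓ) - symKernel q n (2 * (m + k) - ℓ + 2))) := by
  rw [innerTerm, Finset.mul_sum]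
  refine Finset.sum_congr rfl fun k _ => ?_
  obtain ⟨s, hs⟩ : ∃ s : ℤ, s = 2 * m + 2 * k - ℓ := ⟨_, rfl⟩
  have e0 : 2 * (m + (k : ℤ)) - ℓ = s := by rw [hs]; ring
  have e1 : (n : ℤ) - 2 * m - 2 * k + ℓ = n - s := by rw [hs]; ring
  rw [e0, e1, ← hs]
  have p1 := gaussBinom_pair hq0 hq1 n s
  have p2 := gaussBinom_pair hq0 hq1 n (s + 2)
  rw [show (n : ℤ) - (s + 2) - 1 = n - s - 3 by ring, ← sub_sub] at p2
  have c : choose2 (s + 2) = choose2 s + (2 * s + 1) := by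
    have h1 := two_mul_choose2 s
    have h2 := two_mul_choose2 (s + 2)
    linarith
  rw [p1, show 3 * (s + 1) = 2 * s + 1 + (s + 2) by ring, zpow_add₀ hq0 (2 * s + 1)]
  have p3 : ∀ A : ℂ, A - q ^ (2 * s + 1) * gaussBinom q (2 * n - 1) (n - s - 2) -
      q ^ (2 * s + 1) * q ^ (s + 2) * gaussBinom q (2 * n - 1) (n - s - 3) =
      A - q ^ (2 * s + 1) * (gaussBinom q (2 * n - 1) (n - s - 2) +
        q ^ (s + 2) * gaussBinom q (2 * n - 1) (n - s - 3)) := fun A => by ring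
  rw [p3, p2, symKernel, symKernel, c, zpow_add₀ hq0 (choose2 s), zpow_add₀ hq0 (choose2 s),
    signPow, sub_sub]
  ring

/-- A form of the finite `q`-binomial theorem. By Pascal's rule the step from `ℓ` to `ℓ + 1`
multiplies the sum by `1 - q^(ℓ-r)`. -/
theorem sum_gaussBinom_mul_signPow {q : ℂ} (hq0 : q ≠ 0) (hq1 : ‖q‖ < 1) (ℓ : ℕ) (r : ℤ) :
    ∑ k ∈ Finset.range (ℓ + 1), gaussBinom q ℓ k * signPow q (r - k) =
      signPow q r * ∏ i ∈ Finset.range ℓ, (1 - q ^ ((i : ℤ) - r)) := by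
  induction ℓ with
  | zero => simp [gaussBinom, qPoch]
  | succ ℓ ih =>
    have pascal : ∀ k : ℤ, gaussBinom q (ℓ + 1 : ℕ) k =
        gaussBinom q ℓ k + q ^ ((ℓ : ℤ) + 1 - k) * gaussBinom q ℓ (k - 1) := by
      intro k
      rw [gaussBinom_natCast hq0 hq1, gaussBinom_natCast hq0 hq1, gaussBinom_natCast hq0 hq1,
        show (ℓ : ℤ) - k = ((ℓ + 1 : ℕ) : ℤ) - k - 1 by push_cast; ring,
        show (ℓ : ℤ) - (k - 1) = ((ℓ + 1 : ℕ) : ℤ) - k by push_cast; ring,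
        show (ℓ : ℤ) + 1 - k = ((ℓ + 1 : ℕ) : ℤ) - k by push_cast; ring,
        invPoch_sub_one hq1, invPoch_sub_one hq1, qPoch_succ, ← pow_succ', ← zpow_natCast,
        zpow_sub₀ hq0]
      have : q ^ k ≠ 0 := zpow_ne_zero _ hq0
      field_simp
      ring
    have hsh : ∀ k : ℤ, signPow q (r - (k + 1)) = -(q ^ (k - r) * signPow q (r - k)) := by
      intro k
      have h := signPow_add_one hq0 (r - (k + 1))
      rw [show r - (k + 1) + 1 = r - k by ring] at h
      rw [h, show k - r = -(r - k) by ring, zpow_neg]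
      have : q ^ (r - k) ≠ 0 := zpow_ne_zero _ hq0
      field_simp
    have top : gaussBinom q ℓ ((ℓ + 1 : ℕ) : ℤ) = 0 :=
      gaussBinom_eq_zero q hq0 ℓ (ℓ + 1) (Nat.lt_succ_self ℓ)
    have bot : gaussBinom q ℓ (-1) = 0 := if_pos (by norm_num)
    simp only [pascal, add_mul, Finset.sum_add_distrib]
    rw [Finset.sum_range_succ, top, zero_mul, add_zero, ih, Finset.sum_range_succ' _ (ℓ + 1)]
    have e : ∀ k : ℕ, q ^ ((ℓ : ℤ) + 1 - (k + 1 : ℕ)) * gaussBinom q ℓ ((k + 1 : ℕ) - 1) *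
        signPow q (r - (k + 1 : ℕ)) =
        -q ^ ((ℓ : ℤ) - r) * (gaussBinom q ℓ k * signPow q (r - k)) := by
      intro k
      rw [Nat.cast_succ, hsh, add_sub_cancel_right, show (ℓ : ℤ) + 1 - (k + 1) = ℓ - k by ring,
        show (ℓ : ℤ) - r = (ℓ - k) + (k - r) by ring, zpow_add₀ hq0]
      ring
    simp only [e, ← Finset.mul_sum, ih]
    rw [Nat.cast_zero, zero_sub, bot, Finset.prod_range_succ]
    ring

/-- The coefficient `(-1)^j q^{binom(j+1,2)} (q^{j+1})_ℓ`, for all integers `j`. -/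
noncomputable def coeff (q : ℂ) (ℓ : ℕ) (j : ℤ) : ℂ :=
  signPow q j * qPoch (q ^ (j + 1)) q ℓ

theorem signPow_mul_prod {q : ℂ} (hq0 : q ≠ 0) (ℓ : ℕ) (j : ℤ) :
    signPow q (ℓ + j) * ∏ i ∈ Finset.range ℓ, (1 - q ^ ((i : ℤ) - (ℓ + j))) = coeff q ℓ j := by
  unfold coeff
  induction ℓ with
  | zero => simp [qPoch]
  | succ ℓ ih =>
    rw [Finset.prod_range_succ', qPoch_succ, ← mul_assoc (signPow q j), ← ih,
      show ((ℓ + 1 : ℕ) : ℤ) + j = ℓ + j + 1 by push_cast; ring, signPow_add_one hq0,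
      show ((0 : ℕ) : ℤ) - (ℓ + j + 1) = -(ℓ + j + 1) by push_cast; ring, zpow_neg]
    have e : ∀ i : ℕ, ((i + 1 : ℕ) : ℤ) - (ℓ + j + 1) = i - (ℓ + j) := fun i => by push_cast; ring
    simp only [e]
    rw [← zpow_natCast, ← zpow_add₀ hq0, show j + 1 + (ℓ : ℤ) = ℓ + j + 1 by ring]
    have h : q ^ ((ℓ : ℤ) + j + 1) ≠ 0 := zpow_ne_zero _ hq0
    field_simp
    ring

/-- At the reflected point the product of `signPow_mul_prod` has exactly the factors of
`(q^(j+1))_ℓ`, so only the oddness of `signPow` remains. -/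
theorem coeff_neg {q : ℂ} (hq0 : q ≠ 0) (ℓ : ℕ) (j : ℤ) :
    coeff q ℓ (-1 - ℓ - j) = -coeff q ℓ j := by
  rw [← signPow_mul_prod hq0, show (ℓ : ℤ) + (-1 - ℓ - j) = -1 - j by ring, signPow_neg, coeff,
    neg_mul, qPoch]
  congr 2
  refine Finset.prod_congr rfl fun i _ => ?_
  rw [← zpow_natCast, ← zpow_add₀ hq0]
  congr 2
  ring

theorem coeff_eq_zero {q : ℂ} (hq0 : q ≠ 0) (ℓ : ℕ) (j : ℤ) (h1 : -ℓ ≤ j) (h2 : j < 0) :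
    coeff q ℓ j = 0 := by
  rw [coeff, qPoch, Finset.prod_eq_zero (i := (-j - 1).toNat) (Finset.mem_range.2 (by omega)),
    mul_zero]
  rw [← zpow_natCast, ← zpow_add₀ hq0, show j + 1 + ((-j - 1).toNat : ℤ) = 0 by omega, zpow_zero,
    sub_self]

/-! ### Folding the inner sum -/

theorem finite_support_symKernel_sub (q : ℂ) (ℓ n : ℕ) :
    (Function.support fun r : ℤ =>
      symKernel q n (2 * r - ℓ) - symKernel q n (2 * r - ℓ + 2)).Finite := by
  refine (Set.finite_Icc (-(n + ℓ + 2 : ℤ)) (n + ℓ + 2)).subset fun r hr => ?_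
  by_contra hc
  refine hr ?_
  simp only [Set.mem_Icc, not_and_or, not_le] at hc
  have h1 : (n : ℤ) < |2 * r - ℓ| := by rw [lt_abs]; omega
  have h2 : (n : ℤ) < |2 * r - ℓ + 2| := by rw [lt_abs]; omega
  simp only [symKernel_eq_zero q n _ h1, symKernel_eq_zero q n _ h2, sub_zero]

theorem hasSum_innerTerm {q : ℂ} (hq0 : q ≠ 0) (hq1 : ‖q‖ < 1) (ℓ n : ℕ) :
    HasSum (innerTerm q ℓ n) (qPoch q q (2 * n) * ∑' r : ℤ,
      signPow q r * (∏ i ∈ Finset.range ℓ, (1 - q ^ ((i : ℤ) - r))) *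
        (symKernel q n (2 * r - ℓ) - symKernel q n (2 * r - ℓ + 2))) := by
  have hfin := finite_support_symKernel_sub q ℓ n
  have hs : ∀ g : ℤ → ℂ, Summable fun r : ℤ => g r *
      (symKernel q n (2 * r - ℓ) - symKernel q n (2 * r - ℓ + 2)) := fun g =>
    summable_of_hasFiniteSupport (hfin.subset fun r hr => right_ne_zero_of_mul hr)
  simp only [← sum_gaussBinom_mul_signPow hq0 hq1]
  rw [funext (innerTerm_eq hq0 hq1 ℓ n)]
  refine HasSum.mul_left _ ?_
  simp only [Finset.sum_mul]
  rw [Summable.tsum_finsetSum fun k _ => hs _]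
  refine hasSum_sum fun k _ => ?_
  have h := (hs fun r => gaussBinom q ℓ k * signPow q (r - k)).hasSum
  rw [← (Equiv.addRight (k : ℤ)).hasSum_iff] at h
  refine h.congr_fun ?_
  intro m
  simp [mul_assoc]

theorem finite_support_innerTerm {q : ℂ} (hq0 : q ≠ 0) (hq1 : ‖q‖ < 1) (ℓ n : ℕ) :
    (Function.support (innerTerm q ℓ n)).Finite := by
  have hfin := finite_support_symKernel_sub q ℓ n
  refine ((Finset.range (ℓ + 1)).finite_toSet.biUnion (t := fun k : ℕ =>
    (fun m : ℤ => m + k) ⁻¹' Function.support fun r : ℤ =>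
      symKernel q n (2 * r - ℓ) - symKernel q n (2 * r - ℓ + 2)) fun k _ =>
    hfin.preimage (add_left_injective (k : ℤ)).injOn).subset fun m hm => ?_
  rw [Function.mem_support, innerTerm_eq hq0 hq1] at hm
  obtain ⟨k, hk, hne⟩ := Finset.exists_ne_zero_of_sum_ne_zero (right_ne_zero_of_mul hm)
  exact Set.mem_biUnion hk (right_ne_zero_of_mul (right_ne_zero_of_mul hne))

theorem tsum_int_eq_two_mul_tsum_nat (ℓ : ℕ) (h : ℤ → ℂ) (hs : Summable h)
    (hsymm : ∀ j, h (-1 - ℓ - j) = h j) (hzero : ∀ j, -(ℓ : ℤ) ≤ j → j < 0 → h j = 0) :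
    ∑' j : ℤ, h j = 2 * ∑' j : ℕ, h j := by
  have h1 : Summable fun n : ℕ => h n := hs.comp_injective Nat.cast_injective
  have h2 : Summable fun n : ℕ => h (-((n : ℤ) + 1)) :=
    hs.comp_injective fun a b hab => by simpa using hab
  -- Of the terms at `-1, -2, …` the first `ℓ` vanish; the others mirror `j ≥ 0`.
  rw [tsum_of_nat_of_neg_add_one h1 h2, two_mul, ← h2.sum_add_tsum_nat_add ℓ,
    Finset.sum_eq_zero, zero_add]
  · congr 2
    funext j
    rw [← hsymm]
    congr 1
    push_cast
    ring
  · intro i hi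
    rw [Finset.mem_range] at hi
    exact hzero _ (by omega) (by omega)

theorem lhsTerm_eq {q : ℂ} (hq0 : q ≠ 0) (hq1 : ‖q‖ < 1) (ℓ n : ℕ) :
    lhsTerm q ℓ n = 2 * ∑' j : ℕ, q ^ (n * (n + 1)) *
      (coeff q ℓ j * (kernelDiff q n (2 * j + ℓ) + kernelDiff q n (2 * j + ℓ + 1))) := by
  have hne := qPoch_self_ne_zero q hq1 (2 * n)
  rw [lhsTerm, (hasSum_innerTerm hq0 hq1 ℓ n).tsum_eq, ← mul_assoc, div_mul_cancel₀ _ hne,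
    ← (Equiv.addLeft (ℓ : ℤ)).tsum_eq]
  have hfin := finite_support_symKernel_sub q ℓ n
  simp only [Equiv.coe_addLeft, signPow_mul_prod hq0]
  rw [tsum_int_eq_two_mul_tsum_nat ℓ, tsum_mul_left, mul_left_comm]
  · congr 3
    funext j
    rw [← symKernel_sub_symKernel hq0 hq1, ← symKernel_sub_symKernel hq0 hq1, sub_add_sub_cancel,
      show 2 * ((ℓ : ℤ) + j) - ℓ = 2 * j + ℓ by ring, add_assoc _ (1 : ℤ) 1]
    rfl
  · refine summable_of_hasFiniteSupport
      ((hfin.preimage (add_right_injective (ℓ : ℤ)).injOn).subset fun r hr => ?_)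
    exact right_ne_zero_of_mul hr
  · intro j
    rw [coeff_neg hq0, show 2 * ((ℓ : ℤ) + (-1 - ℓ - j)) - ℓ = -(2 * (ℓ + j) - ℓ + 2) by ring,
      symKernel_neg hq0, show -(2 * ((ℓ : ℤ) + j) - ℓ + 2) + 2 = -(2 * (ℓ + j) - ℓ) by ring,
      symKernel_neg hq0]
    ring
  · intro j h1 h2
    rw [coeff_eq_zero hq0 ℓ j h1 h2, zero_mul]

/-! ### The Durfee rectangle identity -/

open Filter Topology

theorem norm_qpow_le_one {q : ℂ} (hq1 : ‖q‖ < 1) (n : ℕ) : ‖q ^ n‖ ≤ 1 := by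
  rw [norm_pow]
  exact pow_le_one₀ (norm_nonneg _) hq1.le

theorem summable_norm_mul_pow {q : ℂ} (hq1 : ‖q‖ < 1) : Summable fun i : ℕ => ‖-(q * q ^ i)‖ := by
  simp only [norm_neg, norm_mul, norm_pow]
  exact (summable_geometric_of_lt_one (norm_nonneg q) hq1).mul_left _

theorem qPochInf_self_ne_zero {q : ℂ} (hq1 : ‖q‖ < 1) : qPochInf q q ≠ 0 := by
  have := tprod_one_add_ne_zero_of_summable (f := fun i : ℕ => -(q * q ^ i)) (fun i => ?_)
    (summable_norm_mul_pow hq1)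
  · simp only [← sub_eq_add_neg] at this
    exact this
  · rw [← sub_eq_add_neg, sub_ne_zero, ← pow_succ']
    have := zpow_ne_one_of_norm_lt_one hq1 (k := (i + 1 : ℕ)) (by positivity)
    rw [zpow_natCast] at this
    exact this.symm

theorem tendsto_qPoch_self {q : ℂ} (hq1 : ‖q‖ < 1) :
    Tendsto (qPoch q q) atTop (𝓝 (qPochInf q q)) := by
  have := (multipliable_one_add_of_summable (summable_norm_mul_pow hq1)).hasProd.tendsto_prod_nat
  simp only [← sub_eq_add_neg] at this
  exact this

theorem exists_norm_invPoch_le {q : ℂ} (hq1 : ‖q‖ < 1) :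
    ∃ C : ℝ, 0 ≤ C ∧ ∀ k, ‖invPoch q k‖ ≤ C := by
  have h := ((tendsto_qPoch_self hq1).inv₀ (qPochInf_self_ne_zero hq1)).norm
  obtain ⟨C, hC⟩ := h.bddAbove_range
  have hC0 : 0 ≤ C := (norm_nonneg _).trans (hC ⟨0, rfl⟩)
  refine ⟨C, hC0, fun k => ?_⟩
  rcases lt_or_ge k 0 with hk | hk
  · rwa [invPoch_of_neg q hk, norm_zero]
  · lift k to ℕ using hk
    rw [invPoch_natCast]
    exact hC ⟨k, rfl⟩

/-- The `i`-th term of the Durfee rectangle series. -/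
noncomputable def durfeeTerm (q : ℂ) (a i : ℕ) : ℂ :=
  q ^ (i * i + i * a) * (invPoch q i * invPoch q (i + a : ℕ))

theorem norm_durfeeTerm_le {q : ℂ} (hq1 : ‖q‖ < 1) {C : ℝ} (hC : 0 ≤ C)
    (h : ∀ k, ‖invPoch q k‖ ≤ C) (a i : ℕ) : ‖durfeeTerm q a i‖ ≤ ‖q‖ ^ i * (C * C) := by
  rw [durfeeTerm, norm_mul, norm_mul, norm_pow]
  have : i ≤ i * i + i * a := (Nat.le_mul_self i).trans (Nat.le_add_right _ _)
  exact mul_le_mul (pow_le_pow_of_le_one (norm_nonneg _) hq1.le this)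
    (mul_le_mul (h _) (h _) (norm_nonneg _) hC) (by positivity) (by positivity)

theorem summable_durfeeTerm {q : ℂ} (hq1 : ‖q‖ < 1) (a : ℕ) : Summable (durfeeTerm q a) := by
  obtain ⟨C, hC, h⟩ := exists_norm_invPoch_le hq1
  exact Summable.of_norm_bounded
    ((summable_geometric_of_lt_one (norm_nonneg q) hq1).mul_right _)
    (norm_durfeeTerm_le hq1 hC h a)

theorem tsum_durfeeTerm_sub {q : ℂ} (hq1 : ‖q‖ < 1) (a : ℕ) :
    ∑' i, durfeeTerm q a i - ∑' i, durfeeTerm q (a + 1) i =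
      q ^ (a + 1) * (∑' i, durfeeTerm q (a + 2) i - ∑' i, durfeeTerm q (a + 1) i) := by
  have s0 := summable_durfeeTerm hq1 a
  have s1 := summable_durfeeTerm hq1 (a + 1)
  have s2 := summable_durfeeTerm hq1 (a + 2)
  -- This combination leaves the factor `1 - q^i`, which kills `i = 0` and lowers `(q)_i`; shifting
  -- `i` then gives the series for `a + 2`.
  set g : ℕ → ℂ := fun i => durfeeTerm q a i - durfeeTerm q (a + 1) i +
    q ^ (a + 1) * durfeeTerm q (a + 1) i with hg
  have hgs : Summable g := (s0.sub s1).add (s1.mul_left _)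
  have hgi : ∀ i : ℕ, g i = q ^ (i * i + i * a) * ((1 - q ^ i) * invPoch q i) *
      invPoch q (i + a + 1 : ℕ) := by
    intro i
    have h := invPoch_sub_one hq1 ((i + a + 1 : ℕ) : ℤ)
    rw [show ((i + a + 1 : ℕ) : ℤ) - 1 = (i + a : ℕ) by push_cast; ring, zpow_natCast] at h
    simp only [hg, durfeeTerm, h, ← add_assoc]
    ring
  have h0 : g 0 = 0 := by simp [hgi]
  have h1 : ∀ i, g (i + 1) = q ^ (a + 1) * durfeeTerm q (a + 2) i := by
    intro i
    have h := invPoch_sub_one hq1 ((i + 1 : ℕ) : ℤ)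
    rw [show ((i + 1 : ℕ) : ℤ) - 1 = (i : ℕ) by push_cast; ring, zpow_natCast] at h
    rw [hgi, ← h, durfeeTerm, show i + 1 + a + 1 = i + (a + 2) by ring]
    ring
  have h2 : ∑' i, g i = q ^ (a + 1) * ∑' i, durfeeTerm q (a + 2) i := by
    rw [hgs.tsum_eq_zero_add, h0, zero_add, ← tsum_mul_left]
    exact tsum_congr h1
  have h3 : ∑' i, g i = ∑' i, durfeeTerm q a i - ∑' i, durfeeTerm q (a + 1) i +
      q ^ (a + 1) * ∑' i, durfeeTerm q (a + 1) i := by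
    rw [hg, (s0.sub s1).tsum_add (s1.mul_left _), s0.tsum_sub s1, tsum_mul_left]
  linear_combination h2 - h3

theorem tendsto_tsum_durfeeTerm {q : ℂ} (hq1 : ‖q‖ < 1) :
    Tendsto (fun a => ∑' i, durfeeTerm q a i) atTop (𝓝 (qPochInf q q)⁻¹) := by
  obtain ⟨C, hC, h⟩ := exists_norm_invPoch_le hq1
  have hlim : ∀ i : ℕ, Tendsto (fun a => durfeeTerm q a i) atTop
      (𝓝 (if i = 0 then (qPochInf q q)⁻¹ else 0)) := by
    intro i
    rcases Nat.eq_zero_or_pos i with rfl | hi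
    · have := (tendsto_qPoch_self hq1).inv₀ (qPochInf_self_ne_zero hq1)
      refine this.congr fun a => ?_
      rw [durfeeTerm, zero_add, invPoch_natCast, invPoch_natCast]
      simp [qPoch]
    · rw [if_neg hi.ne']
      refine squeeze_zero_norm (a := fun a => ‖q‖ ^ a * (C * C)) (fun a => ?_) ?_
      · rw [durfeeTerm, norm_mul, norm_mul, norm_pow]
        have : a ≤ i * i + i * a := (Nat.le_mul_of_pos_left a hi).trans (Nat.le_add_left _ _)
        exact mul_le_mul (pow_le_pow_of_le_one (norm_nonneg _) hq1.le this)
          (mul_le_mul (h _) (h _) (norm_nonneg _) hC) (by positivity) (by positivity)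
      · simpa using (tendsto_pow_atTop_nhds_zero_of_lt_one (norm_nonneg q) hq1).mul_const (C * C)
  have := tendsto_tsum_of_dominated_convergence
    ((summable_geometric_of_lt_one (norm_nonneg q) hq1).mul_right (C * C)) hlim
    (Eventually.of_forall fun a => norm_durfeeTerm_le hq1 hC h a)
  rwa [tsum_ite_eq] at this

/-- By the recurrence the norms of consecutive differences increase with `a`, yet they tend to 0; so
all differences vanish and every value equals the limit. -/
theorem tsum_durfeeTerm {q : ℂ} (hq1 : ‖q‖ < 1) (a : ℕ) :
    ∑' i, durfeeTerm q a i = (qPochInf q q)⁻¹ := by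
  set S : ℕ → ℂ := fun a => ∑' i, durfeeTerm q a i with hS
  have hrec : ∀ a, ‖S a - S (a + 1)‖ ≤ ‖S (a + 1) - S (a + 2)‖ := by
    intro a
    rw [hS]
    simp only
    rw [tsum_durfeeTerm_sub hq1, norm_mul, norm_sub_rev]
    exact mul_le_of_le_one_left (norm_nonneg _) (norm_qpow_le_one hq1 _)
  have hmono : Monotone fun a => ‖S a - S (a + 1)‖ := monotone_nat_of_le_succ hrec
  have hl := tendsto_tsum_durfeeTerm hq1
  have hl0 : Tendsto (fun a => ‖S a - S (a + 1)‖) atTop (𝓝 0) := by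
    simpa using (hl.sub (hl.comp (tendsto_add_atTop_nat 1))).norm
  have hconst : ∀ a, S (a + 1) = S a := fun a => by
    have := hmono.ge_of_tendsto hl0 a
    exact (sub_eq_zero.1 (norm_le_zero_iff.1 this)).symm
  have hconst' : ∀ a, S a = S 0 := fun a => by
    induction a with
    | zero => rfl
    | succ a ih => rw [hconst, ih]
  refine (hconst' a).trans (tendsto_nhds_unique ?_ hl)
  exact tendsto_const_nhds.congr fun b => (hconst' b).symm

/-! ### Summation over `n` and exchange of sums -/

theorem hasSum_kernelDiff {q : ℂ} (hq0 : q ≠ 0) (hq1 : ‖q‖ < 1) (s : ℕ) :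
    HasSum (fun n : ℕ => q ^ (n * (n + 1)) * kernelDiff q n s)
      (q ^ (choose2 s + s * (s + 1)) * (1 - q ^ (2 * s + 1)) * (qPochInf q q)⁻¹) := by
  have h := ((summable_durfeeTerm hq1 (2 * s + 1)).hasSum).mul_left
    (q ^ (choose2 s + s * (s + 1)) * (1 - q ^ (2 * s + 1)))
  rw [tsum_durfeeTerm hq1] at h
  -- Terms with `n < s` vanish; `n = i + s` gives the Durfee series with `a = 2s + 1`, as `n(n+1) =
  -- i² + ia + s(s+1)`.
  rw [← hasSum_nat_add_iff' s, Finset.sum_eq_zero, sub_zero]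
  · refine h.congr_fun ?_
    intro i
    rw [kernelDiff, durfeeTerm, show ((i + s : ℕ) : ℤ) - s = i by push_cast; ring,
      show ((i + s : ℕ) : ℤ) + s + 1 = ((i + (2 * s + 1) : ℕ) : ℤ) by push_cast; ring,
      show ((2 * (s : ℤ)) + 1) = ((2 * s + 1 : ℕ) : ℤ) by push_cast; ring, zpow_natCast,
      zpow_add₀ hq0, show (s : ℤ) * (s + 1) = ((s * (s + 1) : ℕ) : ℤ) by push_cast; ring,
      zpow_natCast]
    ring
  · intro n hn
    rw [Finset.mem_range] at hn
    rw [kernelDiff, invPoch_of_neg q (k := n - s) (by omega), zero_mul, mul_zero, mul_zero]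

theorem norm_zpow_choose2_le {q : ℂ} (hq1 : ‖q‖ < 1) (s : ℤ) : ‖q ^ choose2 s‖ ≤ 1 := by
  obtain ⟨k, hk⟩ := Int.eq_ofNat_of_zero_le (choose2_nonneg s)
  rw [hk, zpow_natCast]
  exact norm_qpow_le_one hq1 k

theorem norm_kernelDiff_le {q : ℂ} (hq1 : ‖q‖ < 1) {C : ℝ} (hC : 0 ≤ C)
    (h : ∀ k, ‖invPoch q k‖ ≤ C) (n s : ℕ) : ‖kernelDiff q n s‖ ≤ 2 * (C * C) := by
  rw [kernelDiff, norm_mul, norm_mul, norm_mul,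
    show ((2 * (s : ℤ)) + 1) = ((2 * s + 1 : ℕ) : ℤ) by push_cast; ring, zpow_natCast]
  have h1 : ‖1 - q ^ (2 * s + 1)‖ ≤ 2 := by
    refine (norm_sub_le _ _).trans ?_
    rw [norm_one]
    linarith [norm_qpow_le_one hq1 (2 * s + 1)]
  refine mul_le_mul ?_ (mul_le_mul (h _) (h _) (norm_nonneg _) hC) (by positivity) (by norm_num)
  calc _ ≤ 1 * (2 : ℝ) :=
        mul_le_mul (norm_zpow_choose2_le hq1 _) h1 (norm_nonneg _) (by norm_num)
    _ = 2 := one_mul _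

theorem coeff_natCast (q : ℂ) (ℓ j : ℕ) :
    coeff q ℓ j = (-1) ^ j * q ^ (j + 1).choose 2 * qPoch (q ^ (j + 1)) q ℓ := by
  have h : choose2 (j + 1) = ((j + 1).choose 2 : ℕ) := by
    rw [Nat.choose_two_right, choose2]
    push_cast
    simp
  rw [coeff, signPow, h, zpow_natCast, zpow_natCast, ← zpow_natCast q (j + 1), Nat.cast_succ]

theorem norm_coeff_le {q : ℂ} (hq1 : ‖q‖ < 1) (ℓ j : ℕ) : ‖coeff q ℓ j‖ ≤ ‖q‖ ^ j * 2 ^ ℓ := by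
  rw [coeff_natCast, norm_mul, norm_mul, norm_pow, norm_pow, norm_neg, norm_one, one_pow, one_mul]
  have hj : j ≤ (j + 1).choose 2 := by
    rw [Nat.choose_succ_succ, Nat.choose_one_right]
    exact Nat.le_add_right _ _
  refine mul_le_mul (pow_le_pow_of_le_one (norm_nonneg _) hq1.le hj) ?_ (norm_nonneg _)
    (by positivity)
  rw [qPoch, norm_prod]
  calc _ ≤ ∏ _i ∈ Finset.range ℓ, (2 : ℝ) := by
        refine Finset.prod_le_prod (fun _ _ => norm_nonneg _) fun i _ => ?_
        refine (norm_sub_le _ _).trans ?_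
        rw [norm_one, ← pow_add]
        linarith [norm_qpow_le_one hq1 (j + 1 + i)]
    _ = 2 ^ ℓ := by simp

/-- The `(n, j)` term of the double series linking both sides. -/
noncomputable def doubleTerm (q : ℂ) (ℓ n j : ℕ) : ℂ :=
  q ^ (n * (n + 1)) *
    (coeff q ℓ j * (kernelDiff q n (2 * j + ℓ) + kernelDiff q n (2 * j + ℓ + 1)))

/-- Dominated by a constant times `‖q‖^n ‖q‖^j`: the kernels are bounded uniformly in `n` and `j`,
and `coeff` decays geometrically in `j`. -/
theorem summable_doubleTerm {q : ℂ} (hq1 : ‖q‖ < 1) (ℓ : ℕ) :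
    Summable fun p : ℕ × ℕ => doubleTerm q ℓ p.1 p.2 := by
  obtain ⟨C, hC, h⟩ := exists_norm_invPoch_le hq1
  have hg := summable_geometric_of_lt_one (norm_nonneg q) hq1
  refine Summable.of_norm_bounded
    ((hg.mul_of_nonneg hg (fun _ => by positivity) fun _ => by positivity).mul_right
      (2 ^ ℓ * (4 * (C * C)))) fun p => ?_
  obtain ⟨n, j⟩ := p
  rw [doubleTerm, norm_mul, norm_mul, norm_pow]
  have h1 : ‖q‖ ^ (n * (n + 1)) ≤ ‖q‖ ^ n :=
    pow_le_pow_of_le_one (norm_nonneg _) hq1.le (Nat.le_mul_of_pos_right n (Nat.succ_pos n))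
  have h2 : ‖kernelDiff q n (2 * j + ℓ) + kernelDiff q n (2 * j + ℓ + 1)‖ ≤ 4 * (C * C) := by
    refine (norm_add_le _ _).trans ?_
    have e1 := norm_kernelDiff_le hq1 hC h n (2 * j + ℓ)
    have e2 := norm_kernelDiff_le hq1 hC h n (2 * j + ℓ + 1)
    push_cast at e1 e2
    linarith
  calc _ ≤ ‖q‖ ^ n * (‖q‖ ^ j * 2 ^ ℓ * (4 * (C * C))) := by
        refine mul_le_mul h1 ?_ (by positivity) (by positivity)
        exact mul_le_mul (norm_coeff_le hq1 ℓ j) h2 (norm_nonneg _) (by positivity)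
    _ = _ := by ring

theorem hasSum_doubleTerm_left {q : ℂ} (hq0 : q ≠ 0) (hq1 : ‖q‖ < 1) (ℓ j : ℕ) :
    HasSum (fun n => doubleTerm q ℓ n j) ((qPochInf q q)⁻¹ * rhsTerm q ℓ j) := by
  have h1 := hasSum_kernelDiff hq0 hq1 (2 * j + ℓ)
  have h2 := hasSum_kernelDiff hq0 hq1 (2 * j + ℓ + 1)
  have h := (h1.add h2).mul_left (coeff q ℓ j)
  have e : ∀ s : ℕ, choose2 s + s * (s + 1) = ((s * (3 * s + 1) / 2 : ℕ) : ℤ) := by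
    intro s
    have := two_mul_choose2 s
    push_cast
    symm
    apply Int.ediv_eq_of_eq_mul_right two_ne_zero
    linarith
  have e' : ∀ s : ℕ, (s + 1) * (3 * (s + 1) + 1) / 2 = s * (3 * s + 1) / 2 + (3 * s + 2) := by
    intro s
    rw [show (s + 1) * (3 * (s + 1) + 1) = s * (3 * s + 1) + 2 * (3 * s + 2) by ring,
      Nat.add_mul_div_left _ _ two_pos]
  rw [e, e, zpow_natCast, zpow_natCast, e'] at h
  have hr : (qPochInf q q)⁻¹ * rhsTerm q ℓ j = coeff q ℓ j *
      (q ^ ((2 * j + ℓ) * (3 * (2 * j + ℓ) + 1) / 2) * (1 - q ^ (2 * (2 * j + ℓ) + 1)) *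
        (qPochInf q q)⁻¹ +
      q ^ ((2 * j + ℓ) * (3 * (2 * j + ℓ) + 1) / 2 + (3 * (2 * j + ℓ) + 2)) *
        (1 - q ^ (2 * (2 * j + ℓ + 1) + 1)) * (qPochInf q q)⁻¹) := by
    rw [coeff_natCast, rhsTerm, show 6 * j + 3 * ℓ + 1 = 3 * (2 * j + ℓ) + 1 by ring]
    ring
  rw [hr]
  refine h.congr_fun ?_
  intro n
  rw [doubleTerm]
  push_cast
  ring

end QSeries

theorem mainTheorem10 (q : ℂ) (hq0 : q ≠ 0) (hq1 : ‖q‖ < 1) (ℓ : ℕ) :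
    (∀ n : ℕ, (Function.support (QSeries.innerTerm q ℓ n)).Finite) ∧
    Summable (QSeries.lhsTerm q ℓ) ∧
    Summable (QSeries.rhsTerm q ℓ) ∧
    ∑' n : ℕ, QSeries.lhsTerm q ℓ n =
      2 / QSeries.qPochInf q q * ∑' j : ℕ, QSeries.rhsTerm q ℓ j := by
  have hs := QSeries.summable_doubleTerm hq1 ℓ
  have hl : QSeries.lhsTerm q ℓ = fun n => 2 * ∑' j, QSeries.doubleTerm q ℓ n j :=
    funext (QSeries.lhsTerm_eq hq0 hq1 ℓ)
  have hr : ∀ j, ∑' n, QSeries.doubleTerm q ℓ n j =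
      (QSeries.qPochInf q q)⁻¹ * QSeries.rhsTerm q ℓ j := fun j =>
    (QSeries.hasSum_doubleTerm_left hq0 hq1 ℓ j).tsum_eq
  refine ⟨QSeries.finite_support_innerTerm hq0 hq1 ℓ, ?_, ?_, ?_⟩
  · rw [hl]
    exact hs.prod.mul_left 2
  · have h := hs.prod_symm.prod
    simp only [Prod.swap, hr] at h
    exact (summable_mul_left_iff (inv_ne_zero (QSeries.qPochInf_self_ne_zero hq1))).1 h
  · have hc : ∑' n, ∑' j, QSeries.doubleTerm q ℓ n j = ∑' j, ∑' n, QSeries.doubleTerm q ℓ n j :=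
      Summable.tsum_comm hs.prod_symm
    simp only [hl]
    rw [tsum_mul_left, hc, tsum_congr hr, tsum_mul_left, ← mul_assoc, div_eq_mul_inv]
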